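/- Fix integers $d\ge 1$ and $D,\kappa,R,K\ge 0$, reals $h$, $\delta>0$, $\beta_c$, a function $c:\mathbb R\to\mathbb R$ and $\beta\in[0,\beta_c)$. Then there are constants $C,\xi>0$, depending only on these data, such that the following holds for every finite set of sites $\Lambda\subset\mathbb Z^D$, $n=|\Lambda|$, with a $d$-dimensional qudit on each site, and every Hamiltonian $H=\sum_{X\subseteq\Lambda}H_X$ whose terms are Hermitian, mutually commuting, supported on $X$, with operator norm $\|H_X\|\le h$, and with $H_X=0$ whenever $\mathrm{diam}(X)>R$ or $|X|>\kappa$ (distances are lattice, i.e. $\ell^1$, distances). Suppose that for every $\beta'\in[0,\beta_c)$, every operator $N\ge 0$ with $\|N\|=1$ supported on at most $K$ sites, and every tuple $(z_X)_{X\subseteq\Lambda}$ of complex numbers with $|z_X-\beta'|\le\delta$ for all $X$, $$\mathrm{Tr}\Big[e^{-\sum_X z_XH_X}N\Big]\ne 0\qquad\text{and}\qquad \Big|\log \mathrm{Tr}\Big[e^{-\sum_X z_XH_X}N\Big]\Big|\le c(\beta')\,n ,$$ where $\log$ is the principal logarithm. Then, with $\rho_\beta(H)=e^{-\beta H}/\mathrm{Tr}[e^{-\beta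 H}]$, for all Hermitian operators $O_1,O_2$ supported on sets $A_1,A_2\subseteq\Lambda$ with $|A_1|+|A_2|\le K$, $$\Big|\mathrm{Tr}[\rho_\beta(H)O_1O_2]-\mathrm{Tr}[\rho_\beta(H)O_1]\,\mathrm{Tr}[\rho_\beta(H)O_2]\Big|\le C\,\|O_1\|\,\|O_2\|\,e^{-\mathrm{dist}(A_1,A_2)/\xi},$$ where $\mathrm{dist}(A_1,A_2)=\min_{x\in A_1,\,y\in A_2}\mathrm{dist}(x,y)$, read as $0$ if $A_1$ or $A_2$ is empty. In particular the bound has no factor of $n$ and holds at every distance. -/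

import Mathlib

open scoped Matrix.Norms.L2Operator ComplexOrder

noncomputable section

namespace QuantumLattice

/-- The sites of the lattice `ℤ^D`. -/
abbrev Site (D : ℕ) : Type := Fin D → ℤ

/-- The lattice (graph, i.e. `ℓ¹`) distance on `ℤ^D`. -/
def siteDist {D : ℕ} (x y : Site D) : ℕ := ∑ i, (x i - y i).natAbs

/-- Operators on `⨂_{x ∈ Λ} ℂ^d`, written in the product basis labelled by the configurations
`Λ → Fin d`. The norm `‖O‖` is the operator norm with respect to the Hilbert space norm. -/
abbrev Operator {D : ℕ} (Λ : Finset (Site D)) (d : ℕ) : Type :=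
  Matrix (Λ → Fin d) (Λ → Fin d) ℂ

variable {D d : ℕ} {Λ : Finset (Site D)}

/-- `O` acts non-trivially only on the sites in `A`: `O = M ⊗ 1` with `M` an operator on
`⨂_{x ∈ A} ℂ^d` and `1` the identity on the sites of `Λ` outside `A`. -/
def SupportedOn (A : Finset Λ) (O : Operator Λ d) : Prop :=
  ∃ M : Matrix (A → Fin d) (A → Fin d) ℂ, ∀ σ τ : Λ → Fin d,
    O σ τ = if ∀ x, x ∉ A → σ x = τ x then M (fun x => σ x) (fun x => τ x) else 0

/-- The diameter of a region. -/
def regionDiam (X : Finset Λ) : ℕ :=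
  (X ×ˢ X).sup fun p => siteDist (p.1 : Site D) (p.2 : Site D)

/-- The distance of two regions, the minimum of `dist(x, y)` over `x ∈ A`, `y ∈ B`
(by convention `0` if one of them is empty). -/
def regionDist (A B : Finset Λ) : ℕ :=
  sInf {r | ∃ x ∈ A, ∃ y ∈ B, siteDist (x : Site D) (y : Site D) = r}

/-- A `(κ, R)`-local Hamiltonian `H = ∑_{X ⊆ Λ} H_X` on the finite lattice `Λ ⊂ ℤ^D` of
`d`-dimensional qudits, with local terms of norm at most `h`. -/
structure LocalHamiltonian (Λ : Finset (Site D)) (d κ R : ℕ) (h : ℝ) where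
  /-- The local term `H_X`. -/
  term : Finset Λ → Operator Λ d
  isHermitian : ∀ X, (term X).IsHermitian
  supportedOn : ∀ X, SupportedOn X (term X)
  norm_le : ∀ X, ‖term X‖ ≤ h
  eq_zero : ∀ X, R < regionDiam X ∨ κ < X.card → term X = 0

namespace LocalHamiltonian

variable {κ R : ℕ} {h : ℝ}

/-- The local terms commute with each other. -/
def MutuallyCommuting (H : LocalHamiltonian Λ d κ R h) : Prop :=
  ∀ X Y, Commute (H.term X) (H.term Y)

/-- The weighted Hamiltonian `∑_X z_X H_X`. -/
def weighted (H : LocalHamiltonian Λ d κ R h) (z : Finset Λ → ℂ) : Operator Λ d :=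
  ∑ X, z X • H.term X

/-- The Gibbs state `ρ_β(H) = e^{-βH} / Tr[e^{-βH}]`. -/
def gibbs (H : LocalHamiltonian Λ d κ R h) (β : ℝ) : Operator Λ d :=
  (Matrix.trace (NormedSpace.exp (-H.weighted fun _ => (β : ℂ))))⁻¹ •
    NormedSpace.exp (-H.weighted fun _ => (β : ℂ))

/-- The set `Γ_{δ,β}` of all tuples `z` with `|z_X - β| ≤ δ` for every `X`. -/
def vicinity (Λ : Finset (Site D)) (δ β : ℝ) : Set (Finset Λ → ℂ) :=
  {z | ∀ X, ‖z X - (β : ℂ)‖ ≤ δ}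

/-- Analyticity after measurement at `β`, for measurement operators `N` that act on at most `K`
sites and with the constant `c`: for all `N ≥ 0` with `‖N‖ = 1` and all `z ∈ Γ_{δ,β}`,
`Tr[e^{-∑ z_X H_X} N] ≠ 0` and `|log Tr[e^{-∑ z_X H_X} N]| ≤ c n`, where `n` is the number of
sites. (The principal logarithm has the least modulus among all logarithms.) -/
def AnalyticAfterMeasurement (H : LocalHamiltonian Λ d κ R h) (K : ℕ) (δ c β : ℝ) : Prop :=
  ∀ (A : Finset Λ) (N : Operator Λ d), A.card ≤ K → SupportedOn A N → N.PosSemidef → ‖N‖ = 1 →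
    ∀ z ∈ vicinity Λ δ β,
      Matrix.trace (NormedSpace.exp (-H.weighted z) * N) ≠ 0 ∧
      ‖Complex.log (Matrix.trace (NormedSpace.exp (-H.weighted z) * N))‖ ≤ c * (Λ.card : ℝ)

/-- Exponential decay of correlations in `ρ_β(H)` with constants `C` and `ξ`, for Hermitian
observables that act on at most `K` sites in total. -/
def ExponentialDecay (H : LocalHamiltonian Λ d κ R h) (K : ℕ) (C ξ β : ℝ) : Prop :=
  ∀ (A₁ A₂ : Finset Λ) (O₁ O₂ : Operator Λ d), A₁.card + A₂.card ≤ K →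
    SupportedOn A₁ O₁ → SupportedOn A₂ O₂ → O₁.IsHermitian → O₂.IsHermitian →
    ‖Matrix.trace (H.gibbs β * O₁ * O₂) -
        Matrix.trace (H.gibbs β * O₁) * Matrix.trace (H.gibbs β * O₂)‖ ≤
      C * ‖O₁‖ * ‖O₂‖ * Real.exp (-(regionDist A₁ A₂ : ℝ) / ξ)

end LocalHamiltonian

end QuantumLattice

end

/-!
By hypothesis `Tr[e^{-zH} N] ≠ 0` for positive `N` on few sites and `z` near the segment `[0, β]`.
Composing `z` with a holomorphic map from a disc of radius `r > 1` into a neighbourhood of the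
segment, with `0 ↦ 0` and `1 ↦ β`, gives a holomorphic family of normalized functionals `φ_w`,
with no zeros at nonzero positive operators. For self-adjoint `O` the function `2‖O‖ + φ_w(O)`
avoids the negative real axis, since otherwise `φ_w` would vanish at some positive operator
`O + 2‖O‖ + s`. A function with values in the slit plane is controlled by its value at `0`, where
`φ_0` is the normalized trace; hence the expectations are bounded on smaller discs by constants
that do not see the size of the system.

On two copies of the system, the covariance of `O₁` and `O₂` is proportional to the trace of
`e^{-z(H ⊗ 1 + 1 ⊗ H)} (O₁ ⊗ 1 - 1 ⊗ O₁) (O₂ ⊗ 1 - 1 ⊗ O₂)`. In the expansion in powers of `z`, a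
product of few local terms does not connect `A₁` with `A₂`; exchanging the two copies on the sites
that it connects with `A₁` flips the sign of its contribution, which therefore vanishes. So the
covariance vanishes at `w = 0` to an order proportional to `dist(A₁, A₂)`, and the Schwarz lemma
turns this into exponential decay at `w = 1`.
-/

open Metric Filter Topology Asymptotics
open scoped Kronecker MatrixOrder

namespace QuantumLattice

section ComplexAnalysis

theorem norm_le_mul_pow_of_isBigO {E F : Type*} [NormedAddCommGroup E] [NormedSpace ℂ E]
    [NormedAddCommGroup F] [NormedSpace ℂ F] {f : E → F} {r C : ℝ} {k : ℕ}
    (hf : DifferentiableOn ℂ f (ball 0 r)) (hC : ∀ w ∈ ball (0 : E) r, ‖f w‖ ≤ C)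
    (hO : f =O[𝓝 0] fun w => ‖w‖ ^ k) {w : E} (hw : w ∈ ball (0 : E) r) :
    ‖f w‖ ≤ C * (‖w‖ / r) ^ k := by
  cases k with
  | zero => simpa using hC w hw
  | succ n =>
    have hf0 : f 0 = 0 := IsBigO.eq_zero_of_norm_pow (by simpa using hO) n.succ_ne_zero
    have ho : f =o[𝓝 0] fun w => ‖w‖ ^ n :=
      hO.trans_isLittleO ((isLittleO_pow_pow n.lt_succ_self).comp_tendsto tendsto_norm_zero)
    simpa [hf0] using Complex.dist_le_mul_div_pow_of_mapsTo_ball_of_isLittleO hf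
      (fun z hz => by simpa [hf0] using hC z hz) (by simpa [hf0] using ho) hw

theorem isBigO_pow_comp {𝕜 E : Type*} [NontriviallyNormedField 𝕜] [Norm E] {f : 𝕜 → E} {k : ℕ}
    (hf : f =O[𝓝 0] fun t => t ^ k) {ψ : 𝕜 → 𝕜} (hψ : DifferentiableAt 𝕜 ψ 0) (hψ0 : ψ 0 = 0) :
    (fun w => f (ψ w)) =O[𝓝 0] fun w => w ^ k := by
  have hlin : ψ =O[𝓝 0] fun w => w := by
    simpa only [hψ0, sub_zero] using hψ.isBigO_sub
  have htendsto : Tendsto ψ (𝓝 0) (𝓝 0) := by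
    simpa only [hψ0] using hψ.continuousAt.tendsto
  exact (hf.comp_tendsto htendsto).trans (hlin.pow k)

/- The square root of `f` maps into the right half-plane, so Borel–Carathéodory applies to it. -/
theorem norm_le_of_mem_slitPlane {f : ℂ → ℂ} {r : ℝ} (hf : DifferentiableOn ℂ f (ball 0 r))
    (hslit : ∀ w ∈ ball (0 : ℂ) r, f w ∈ Complex.slitPlane) {w : ℂ} (hw : w ∈ ball (0 : ℂ) r) :
    ‖f w‖ ≤ (4 * r / (r - ‖w‖)) ^ 2 * ‖f 0‖ := by
  have hwr : ‖w‖ < r := mem_ball_zero_iff.1 hw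
  have hr : 0 < r := (norm_nonneg w).trans_lt hwr
  have norm_sqrt_sq (z : ℂ) : ‖Complex.sqrt z‖ ^ 2 = ‖z‖ := by
    rw [← norm_pow, Complex.sqrt, Complex.cpow_ofNat_inv_pow]
  have hsqrt : ‖Complex.sqrt (f w)‖ ≤ 4 * r / (r - ‖w‖) * ‖Complex.sqrt (f 0)‖ := by
    have hpos : 0 < ‖Complex.sqrt (f 0)‖ := by
      refine norm_pos_iff.2 fun h0 => Complex.slitPlane_ne_zero (hslit 0 (mem_ball_self hr)) ?_
      rw [← norm_eq_zero, ← norm_sqrt_sq, h0, norm_zero, sq, mul_zero]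
    have hbc := Complex.borelCaratheodory (f := fun w => -Complex.sqrt (f w)) hpos
      (Complex.differentiableOn_sqrt.comp hf hslit).neg
      (fun z _ => by
        have hre : 0 ≤ (Complex.sqrt (f z)).re := by
          rw [Complex.sqrt, Complex.cpow_inv_two_re]; positivity
        simpa using (neg_nonpos.2 hre).trans hpos.le) hr hw
    simp only [norm_neg] at hbc
    calc ‖Complex.sqrt (f w)‖
        ≤ _ := hbc
      _ = (r + 3 * ‖w‖) / (r - ‖w‖) * ‖Complex.sqrt (f 0)‖ := by ring
      _ ≤ 4 * r / (r - ‖w‖) * ‖Complex.sqrt (f 0)‖ := by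
        gcongr
        linarith
  calc ‖f w‖ = ‖Complex.sqrt (f w)‖ ^ 2 := (norm_sqrt_sq _).symm
    _ ≤ (4 * r / (r - ‖w‖) * ‖Complex.sqrt (f 0)‖) ^ 2 := by gcongr
    _ = (4 * r / (r - ‖w‖)) ^ 2 * ‖f 0‖ := by rw [mul_pow, norm_sqrt_sq]

theorem exists_mem_Icc_norm_neg_log_one_sub_sub_le {l : ℝ} (hl : 0 ≤ l) {z : ℂ}
    (hz : ‖z‖ ≤ 1 - Real.exp (-(l + 1))) :
    ∃ s ∈ Set.Icc 0 l, ‖-Complex.log (1 - z) - (s : ℂ)‖ ≤ 3 := by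
  have hz1 : ‖z‖ < 1 := hz.trans_lt (sub_lt_self 1 (Real.exp_pos _))
  have hlower : Real.exp (-(l + 1)) ≤ ‖1 - z‖ := by
    have := norm_sub_norm_le 1 z
    rw [norm_one] at this
    linarith
  have hupper : ‖1 - z‖ ≤ Real.exp 1 := by
    have := norm_sub_le 1 z
    rw [norm_one] at this
    linarith [Real.add_one_le_exp 1]
  have hpos : 0 < ‖1 - z‖ := (Real.exp_pos _).trans_le hlower
  have hlog_lower : -(l + 1) ≤ Real.log ‖1 - z‖ := (Real.le_log_iff_exp_le hpos).2 hlower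
  have hlog_upper : Real.log ‖1 - z‖ ≤ 1 := (Real.log_le_iff_le_exp hpos).2 hupper
  have harg : |(1 - z).arg| ≤ 2 := by
    have hre : 0 ≤ (1 - z).re := by
      rw [Complex.sub_re, Complex.one_re]
      linarith [Complex.re_le_norm z]
    linarith [Complex.abs_arg_le_pi_div_two_iff.2 hre, Real.pi_le_four]
  obtain ⟨s, hs, hdist⟩ : ∃ s ∈ Set.Icc 0 l, |-Real.log ‖1 - z‖ - s| ≤ 1 := by
    refine ⟨max 0 (min l (-Real.log ‖1 - z‖)), ⟨le_max_left _ _, max_le hl (min_le_left _ _)⟩, ?_⟩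
    grind
  refine ⟨s, hs, (Complex.norm_le_abs_re_add_abs_im _).trans ?_⟩
  simp only [Complex.sub_re, Complex.neg_re, Complex.log_re, Complex.ofReal_re, Complex.sub_im,
    Complex.neg_im, Complex.log_im, Complex.ofReal_im, sub_zero, abs_neg]
  linarith

/- `w ↦ -log (1 - q w)` maps the disc onto a neighbourhood of a segment whose width stays bounded
while its length `l` grows as `q → 1`; rescaling the length to `β` makes the width small. -/
theorem exists_disc_map_near_segment {β δ : ℝ} (hβ : 0 ≤ β) (hδ : 0 < δ) :
    ∃ r > 1, ∃ ψ : ℂ → ℂ, DifferentiableOn ℂ ψ (ball 0 r) ∧ ψ 0 = 0 ∧ ψ 1 = β ∧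
      ∀ w ∈ ball (0 : ℂ) r, ∃ β' ∈ Set.Icc 0 β, ‖ψ w - (β' : ℂ)‖ ≤ δ := by
  obtain ⟨l, hl0, hl⟩ : ∃ l > 0, β * 3 / l ≤ δ := by
    refine ⟨β * 3 / δ + 1, by positivity, ?_⟩
    rw [div_le_iff₀ (by positivity), mul_add, mul_div_cancel₀ _ hδ.ne']
    linarith
  have hexp : Real.exp (-(l + 1)) < Real.exp (-l) := Real.exp_lt_exp.2 (by linarith)
  have hexp1 : Real.exp (-l) < 1 := Real.exp_lt_one_iff.2 (neg_lt_zero.2 hl0)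
  set q : ℝ := 1 - Real.exp (-l) with hq
  have hq0 : 0 < q := sub_pos.2 hexp1
  have hmul (w : ℂ) (hw : w ∈ ball (0 : ℂ) ((1 - Real.exp (-(l + 1))) / q)) :
      ‖(q : ℂ) * w‖ ≤ 1 - Real.exp (-(l + 1)) := by
    rw [norm_mul, Complex.norm_of_nonneg hq0.le, ← le_div_iff₀' hq0]
    exact (mem_ball_zero_iff.1 hw).le
  refine ⟨(1 - Real.exp (-(l + 1))) / q, (one_lt_div hq0).2 (by linarith),
    fun w => (β / l : ℝ) * -Complex.log (1 - q * w), ?_, by simp, ?_, fun w hw => ?_⟩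
  · refine (DifferentiableOn.clog (by fun_prop) fun w hw => Or.inl ?_).neg.const_mul _
    rw [Complex.sub_re, Complex.one_re, sub_pos]
    exact (Complex.re_le_norm _).trans_lt ((hmul w hw).trans_lt (sub_lt_self 1 (Real.exp_pos _)))
  · have : (1 - (q : ℂ) * 1) = (Real.exp (-l) : ℝ) := by rw [hq]; push_cast; ring
    simp only [this]
    rw [← Complex.ofReal_log (Real.exp_pos _).le, Real.log_exp]
    norm_cast
    field_simp
  · obtain ⟨s, hs, hdist⟩ := exists_mem_Icc_norm_neg_log_one_sub_sub_le hl0.le (hmul w hw)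
    refine ⟨β / l * s, ⟨mul_nonneg (by positivity) hs.1, ?_⟩, ?_⟩
    · calc β / l * s ≤ β / l * l := by gcongr; exact hs.2
        _ = β := div_mul_cancel₀ _ hl0.ne'
    · rw [Complex.ofReal_mul, ← mul_sub, norm_mul, Complex.norm_of_nonneg (by positivity)]
      calc β / l * _ ≤ β / l * 3 := by gcongr
        _ = β * 3 / l := by ring
        _ ≤ δ := hl

end ComplexAnalysis

section Covariance

variable {𝓐 : Type*} [Ring 𝓐] [Algebra ℂ 𝓐]

/-- The covariance (connected correlation) of `a` and `b` in the functional `φ`. -/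
def covariance (φ : 𝓐 →ₗ[ℂ] ℂ) (a b : 𝓐) : ℂ := φ (a * b) - φ a * φ b

end Covariance

section ZeroFree

open scoped ComplexStarModule

variable {𝓐 : Type*} [CStarAlgebra 𝓐] [PartialOrder 𝓐] [StarOrderedRing 𝓐]

/-- A family of normalized functionals, depending analytically on a parameter in the disc of
radius `r`, none of which vanishes on a nonzero positive element of `S`. The members other than
`φ 0` need not be positive. -/
structure ZeroFreeFamily (S : StarSubalgebra ℂ 𝓐) (r : ℝ) (φ : ℂ → 𝓐 →ₗ[ℂ] ℂ) : Prop where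
  differentiableOn : ∀ a ∈ S, DifferentiableOn ℂ (fun w => φ w a) (ball 0 r)
  map_one : ∀ w ∈ ball (0 : ℂ) r, φ w 1 = 1
  norm_zero_le : ∀ a ∈ S, ‖φ 0 a‖ ≤ ‖a‖
  ne_zero : ∀ w ∈ ball (0 : ℂ) r, ∀ a ∈ S, 0 ≤ a → a ≠ 0 → φ w a ≠ 0

namespace ZeroFreeFamily

variable {S : StarSubalgebra ℂ 𝓐} {r : ℝ} {φ : ℂ → 𝓐 →ₗ[ℂ] ℂ}

theorem two_mul_norm_add_mem_slitPlane (hφ : ZeroFreeFamily S r φ) {a : 𝓐} (ha : a ∈ S)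
    (hsa : IsSelfAdjoint a) (ha0 : a ≠ 0) {w : ℂ} (hw : w ∈ ball (0 : ℂ) r) :
    2 * (‖a‖ : ℂ) + φ w a ∈ Complex.slitPlane := by
  by_contra hslit
  obtain ⟨s, hs, hφa⟩ : ∃ s : ℝ, 0 ≤ s ∧ 2 * (‖a‖ : ℂ) + φ w a = -s := by
    rw [Complex.mem_slitPlane_iff, not_or, not_lt, not_not] at hslit
    exact ⟨-(2 * (‖a‖ : ℂ) + φ w a).re, neg_nonneg.2 hslit.1,
      Complex.ext (by simp) (by simpa using hslit.2)⟩
  have hnorm : 0 < ‖a‖ := norm_pos_iff.2 ha0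
  have hshift : algebraMap ℝ 𝓐 (2 * ‖a‖ + s) = (2 * ‖a‖ + s : ℂ) • 1 := by
    rw [Algebra.algebraMap_eq_smul_one, ← Complex.coe_smul]
    push_cast
    rfl
  refine hφ.ne_zero w hw (algebraMap ℝ 𝓐 (2 * ‖a‖ + s) + a) ?_ ?_ ?_ ?_
  · exact add_mem (hshift ▸ S.smul_mem (one_mem S) _) ha
  · calc (0 : 𝓐) ≤ algebraMap ℝ 𝓐 (‖a‖ + s) := algebraMap_nonneg 𝓐 (by positivity)
      _ = algebraMap ℝ 𝓐 (2 * ‖a‖ + s) + -algebraMap ℝ 𝓐 ‖a‖ := by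
        rw [← map_neg, ← map_add]
        congr 1
        ring
      _ ≤ algebraMap ℝ 𝓐 (2 * ‖a‖ + s) + a := by grw [hsa.neg_algebraMap_norm_le_self]
  · intro h0
    have : Nontrivial 𝓐 := ⟨a, 0, ha0⟩
    have ha_norm : ‖a‖ = 2 * ‖a‖ + s := by
      conv_lhs => rw [eq_neg_of_add_eq_zero_right h0, norm_neg, norm_algebraMap',
        Real.norm_of_nonneg (by positivity)]
    linarith
  · rw [map_add, hshift, map_smul, hφ.map_one w hw, smul_eq_mul, mul_one]
    linear_combination hφa

theorem norm_apply_le_of_isSelfAdjoint (hφ : ZeroFreeFamily S r φ) {a : 𝓐} (ha : a ∈ S)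
    (hsa : IsSelfAdjoint a) {w : ℂ} (hw : w ∈ ball (0 : ℂ) r) :
    ‖φ w a‖ ≤ 5 * (4 * r / (r - ‖w‖)) ^ 2 * ‖a‖ := by
  rcases eq_or_ne a 0 with rfl | ha0
  · simp
  have hwr : ‖w‖ < r := mem_ball_zero_iff.1 hw
  have hr : 0 < r := (norm_nonneg w).trans_lt hwr
  have hgrowth := norm_le_of_mem_slitPlane
    ((hφ.differentiableOn a ha).const_add (2 * (‖a‖ : ℂ)))
    (fun w hw => hφ.two_mul_norm_add_mem_slitPlane ha hsa ha0 hw) hw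
  have hnorm : ‖2 * (‖a‖ : ℂ)‖ = 2 * ‖a‖ := by simp
  have hfactor : 1 ≤ (4 * r / (r - ‖w‖)) ^ 2 := by
    refine one_le_pow₀ ((one_le_div (sub_pos.2 hwr)).2 ?_)
    linarith [norm_nonneg w]
  calc ‖φ w a‖ = ‖2 * (‖a‖ : ℂ) + φ w a - 2 * (‖a‖ : ℂ)‖ := by rw [add_sub_cancel_left]
    _ ≤ (4 * r / (r - ‖w‖)) ^ 2 * (2 * ‖a‖ + ‖φ 0 a‖) + 2 * ‖a‖ := by
      refine (norm_sub_le _ _).trans ?_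
      grw [hgrowth, norm_add_le, hnorm]
    _ ≤ (4 * r / (r - ‖w‖)) ^ 2 * (2 * ‖a‖ + ‖a‖) + (4 * r / (r - ‖w‖)) ^ 2 * (2 * ‖a‖) := by
      refine add_le_add ?_ (le_mul_of_one_le_left (by positivity) hfactor)
      grw [hφ.norm_zero_le a ha]
    _ = 5 * (4 * r / (r - ‖w‖)) ^ 2 * ‖a‖ := by ring

theorem norm_apply_le (hφ : ZeroFreeFamily S r φ) {a : 𝓐} (ha : a ∈ S) {w : ℂ}
    (hw : w ∈ ball (0 : ℂ) r) : ‖φ w a‖ ≤ 10 * (4 * r / (r - ‖w‖)) ^ 2 * ‖a‖ := by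
  have hre : (ℜ a : 𝓐) ∈ S := by
    rw [realPart_apply_coe, ← Complex.coe_smul]
    exact S.smul_mem (add_mem ha (star_mem ha)) _
  have him : (ℑ a : 𝓐) ∈ S := by
    rw [imaginaryPart_apply_coe, ← Complex.coe_smul (2⁻¹ : ℝ)]
    exact S.smul_mem (S.smul_mem (sub_mem ha (star_mem ha)) _) _
  have hnre : ‖(ℜ a : 𝓐)‖ ≤ ‖a‖ := realPart.norm_le a
  have hnim : ‖(ℑ a : 𝓐)‖ ≤ ‖a‖ := imaginaryPart.norm_le a
  calc ‖φ w a‖ = ‖φ w (ℜ a) + Complex.I * φ w (ℑ a)‖ := by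
        rw [← smul_eq_mul, ← map_smul, ← map_add, realPart_add_I_smul_imaginaryPart]
    _ ≤ ‖φ w (ℜ a)‖ + ‖φ w (ℑ a)‖ := by
        refine (norm_add_le _ _).trans_eq ?_
        rw [norm_mul, Complex.norm_I, one_mul]
    _ ≤ 5 * (4 * r / (r - ‖w‖)) ^ 2 * ‖a‖ + 5 * (4 * r / (r - ‖w‖)) ^ 2 * ‖a‖ := by
        grw [hφ.norm_apply_le_of_isSelfAdjoint hre (ℜ a).2 hw,
          hφ.norm_apply_le_of_isSelfAdjoint him (ℑ a).2 hw, hnre, hnim]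
    _ = 10 * (4 * r / (r - ‖w‖)) ^ 2 * ‖a‖ := by ring

theorem norm_covariance_le (hφ : ZeroFreeFamily S r φ) {a b : 𝓐} (ha : a ∈ S) (hb : b ∈ S)
    {ρ : ℝ} (hρ : ρ < r) {w : ℂ} (hw : w ∈ ball (0 : ℂ) ρ) :
    ‖covariance (φ w) a b‖ ≤
      (10 * (4 * r / (r - ρ)) ^ 2 + (10 * (4 * r / (r - ρ)) ^ 2) ^ 2) * ‖a‖ * ‖b‖ := by
  have hwρ : ‖w‖ < ρ := mem_ball_zero_iff.1 hw
  have hr : 0 < r := (norm_nonneg w).trans_lt (hwρ.trans hρ)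
  set B : ℝ := 10 * (4 * r / (r - ρ)) ^ 2
  have hbound {x : 𝓐} (hx : x ∈ S) : ‖φ w x‖ ≤ B * ‖x‖ := by
    refine (hφ.norm_apply_le hx (ball_subset_ball hρ.le hw)).trans ?_
    have : 0 < r - ρ := sub_pos.2 hρ
    have : 0 < r - ‖w‖ := by linarith
    simp only [B]
    gcongr
  calc ‖covariance (φ w) a b‖
      ≤ ‖φ w (a * b)‖ + ‖φ w a‖ * ‖φ w b‖ := by
        rw [← norm_mul]; exact norm_sub_le _ _
    _ ≤ B * (‖a‖ * ‖b‖) + (B * ‖a‖) * (B * ‖b‖) := by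
        gcongr
        · exact (hbound (mul_mem ha hb)).trans (by gcongr; exact norm_mul_le a b)
        · exact hbound ha
        · exact hbound hb
    _ = (B + B ^ 2) * ‖a‖ * ‖b‖ := by ring

theorem norm_covariance_le_mul_pow (hφ : ZeroFreeFamily S r φ) {a b : 𝓐} (ha : a ∈ S)
    (hb : b ∈ S) {k : ℕ} (hk : (fun w => covariance (φ w) a b) =O[𝓝 0] fun w => w ^ k)
    {ρ : ℝ} (hρ : ρ < r) {w : ℂ} (hw : w ∈ ball (0 : ℂ) ρ) :
    ‖covariance (φ w) a b‖ ≤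
      (10 * (4 * r / (r - ρ)) ^ 2 + (10 * (4 * r / (r - ρ)) ^ 2) ^ 2) * ‖a‖ * ‖b‖ *
        (‖w‖ / ρ) ^ k := by
  refine norm_le_mul_pow_of_isBigO ?_ (fun z hz => hφ.norm_covariance_le ha hb hρ hz)
    (by simpa using hk.norm_right) hw
  exact ((hφ.differentiableOn _ (mul_mem ha hb)).sub
    ((hφ.differentiableOn a ha).mul (hφ.differentiableOn b hb))).mono (ball_subset_ball hρ.le)

end ZeroFreeFamily

end ZeroFree

section Matrices

open Matrix

theorem sum_pow_eq_sum_prod_ofFn {ι A : Type*} [Fintype ι] [Semiring A] (f : ι → A) (k : ℕ) :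
    (∑ i, f i) ^ k = ∑ p : Fin k → ι, (List.ofFn fun j => f (p j)).prod := by
  simpa only [MultilinearMap.mkPiAlgebraFin_apply, List.ofFn_const, List.prod_replicate] using
    (MultilinearMap.mkPiAlgebraFin ℕ k A).map_sum fun _ i => f i

theorem trace_eq_zero_of_submatrix_eq_neg {n R : Type*} [Fintype n] [AddCommGroup R]
    [IsAddTorsionFree R] (e : Equiv.Perm n) {M : Matrix n n R} (h : M.submatrix e e = -M) :
    M.trace = 0 := by
  have htrace : (M.submatrix e e).trace = M.trace := Equiv.sum_comp e fun i => M i i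
  rw [h, trace_neg] at htrace
  exact self_eq_neg.1 htrace.symm

theorem norm_apply_le_l2_opNorm {m n 𝕜 : Type*} [RCLike 𝕜] [Fintype m] [Fintype n]
    [DecidableEq n] (M : Matrix m n 𝕜) (i : m) (j : n) : ‖M i j‖ ≤ ‖M‖ := by
  calc ‖M i j‖ = ‖(M *ᵥ Pi.single j 1) i‖ := by rw [mulVec_single_one, col_apply]
    _ ≤ ‖WithLp.toLp 2 (M *ᵥ Pi.single j 1)‖ :=
      PiLp.norm_apply_le (WithLp.toLp 2 (M *ᵥ Pi.single j 1)) i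
    _ ≤ ‖M‖ * ‖EuclideanSpace.single j (1 : 𝕜)‖ := l2_opNorm_mulVec M (EuclideanSpace.single j 1)
    _ = ‖M‖ := by rw [PiLp.norm_single, norm_one, mul_one]

theorem norm_trace_le {n 𝕜 : Type*} [RCLike 𝕜] [Fintype n] [DecidableEq n]
    (M : Matrix n n 𝕜) : ‖M.trace‖ ≤ Fintype.card n * ‖M‖ := by
  calc ‖M.trace‖ ≤ ∑ i, ‖M i i‖ := norm_sum_le _ _
    _ ≤ ∑ _i : n, ‖M‖ := Finset.sum_le_sum fun i _ => norm_apply_le_l2_opNorm M i i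
    _ = Fintype.card n * ‖M‖ := by rw [Finset.sum_const, nsmul_eq_mul, Finset.card_univ]

variable {n : Type*} [Fintype n] [DecidableEq n]

theorem differentiable_trace_exp_smul_mul (T N : Matrix n n ℂ) :
    Differentiable ℂ fun t : ℂ => (NormedSpace.exp (t • T) * N).trace := fun t =>
  ((traceLinearMap n ℂ ℂ).comp (LinearMap.mulRight ℂ N)).toContinuousLinearMap.differentiableAt.comp
    t (hasDerivAt_exp_smul_const T t).differentiableAt

theorem isBigO_trace_exp_smul_mul (T N : Matrix n n ℂ) {k : ℕ}
    (h : ∀ j < k, (T ^ j * N).trace = 0) :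
    (fun t : ℂ => (NormedSpace.exp (t • T) * N).trace) =O[𝓝 0] fun t => t ^ k := by
  set τ : Matrix n n ℂ →L[ℂ] ℂ :=
    ((traceLinearMap n ℂ ℂ).comp (LinearMap.mulRight ℂ N)).toContinuousLinearMap
  have hτ (M : Matrix n n ℂ) : τ M = (M * N).trace := rfl
  have hpartial (t : ℂ) :
      τ ((NormedSpace.expSeries ℂ (Matrix n n ℂ)).partialSum k (t • T)) = 0 := by
    rw [FormalMultilinearSeries.partialSum, map_sum]
    refine Finset.sum_eq_zero fun j hj => ?_
    rw [NormedSpace.expSeries_apply_eq, smul_pow, map_smul, map_smul, hτ,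
      h j (Finset.mem_range.1 hj), smul_zero, smul_zero]
  have htendsto : Tendsto (fun t : ℂ => t • T) (𝓝 0) (𝓝 0) :=
    (continuous_id.smul continuous_const).tendsto' 0 0 (zero_smul ℂ T)
  have htaylor := ((NormedSpace.exp_hasFPowerSeriesAt_zero (𝕂 := ℂ)
    (𝔸 := Matrix n n ℂ)).isBigO_sub_partialSum_pow k).comp_tendsto htendsto
  calc (fun t : ℂ => (NormedSpace.exp (t • T) * N).trace)
      = fun t : ℂ => τ (NormedSpace.exp (0 + t • T) -
          (NormedSpace.expSeries ℂ (Matrix n n ℂ)).partialSum k (t • T)) := by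
        funext t
        rw [map_sub, hpartial, sub_zero, zero_add, hτ]
    _ =O[𝓝 0] fun t : ℂ => ‖t • T‖ ^ k := (τ.isBigO_comp _ _).trans htaylor
    _ =O[𝓝 0] fun t : ℂ => t ^ k := by
        refine IsBigO.of_bound (‖T‖ ^ k) (Eventually.of_forall fun t => ?_)
        rw [norm_pow, norm_norm, norm_smul, mul_pow, norm_pow, mul_comm]

section TensorFactors

variable {m : Type*} [Fintype m] [DecidableEq m]

/-- The algebra embedding `O ↦ O ⊗ 1` into the operators on a composite system: the action on the
left tensor factor. -/
noncomputable def leftCopy : Matrix m m ℂ →ₐ[ℂ] Matrix (m × n) (m × n) ℂ :=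
  (kroneckerAlgEquiv m n ℂ).toAlgHom.comp Algebra.TensorProduct.includeLeft

/-- The algebra embedding `O ↦ 1 ⊗ O` into the operators on a composite system: the action on the
right tensor factor. -/
noncomputable def rightCopy : Matrix n n ℂ →ₐ[ℂ] Matrix (m × n) (m × n) ℂ :=
  (kroneckerAlgEquiv m n ℂ).toAlgHom.comp Algebra.TensorProduct.includeRight

theorem leftCopy_apply (O : Matrix m m ℂ) :
    (leftCopy O : Matrix (m × n) (m × n) ℂ) = O ⊗ₖ 1 := rfl

theorem rightCopy_apply (O : Matrix n n ℂ) :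
    (rightCopy O : Matrix (m × n) (m × n) ℂ) = 1 ⊗ₖ O := rfl

theorem leftCopy_mul_rightCopy (A : Matrix m m ℂ) (B : Matrix n n ℂ) :
    leftCopy A * rightCopy B = A ⊗ₖ B := by
  rw [leftCopy_apply, rightCopy_apply, ← mul_kronecker_mul, mul_one, one_mul]

theorem commute_leftCopy_rightCopy (A : Matrix m m ℂ) (B : Matrix n n ℂ) :
    Commute (leftCopy A) (rightCopy B) := by
  rw [Commute, SemiconjBy, leftCopy_mul_rightCopy, leftCopy_apply, rightCopy_apply,
    ← mul_kronecker_mul, one_mul, mul_one]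

theorem map_exp_algHom (f : Matrix n n ℂ →ₐ[ℂ] Matrix m m ℂ) (T : Matrix n n ℂ) :
    f (NormedSpace.exp T) = NormedSpace.exp (f T) := by
  let _ : NormedAlgebra ℚ (Matrix n n ℂ) := NormedAlgebra.restrictScalars ℚ ℂ _
  exact NormedSpace.map_exp f (LinearMap.continuous_of_finiteDimensional f.toLinearMap) T

end TensorFactors

/-- The operator `O ⊗ 1 + 1 ⊗ O` on two copies of a system, symmetric under their exchange. -/
noncomputable def doubled : Matrix n n ℂ →ₗ[ℂ] Matrix (n × n) (n × n) ℂ :=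
  leftCopy.toLinearMap + rightCopy.toLinearMap

/-- The operator `O ⊗ 1 - 1 ⊗ O` on two copies of a system, antisymmetric under their exchange. -/
noncomputable def antidoubled : Matrix n n ℂ →ₗ[ℂ] Matrix (n × n) (n × n) ℂ :=
  leftCopy.toLinearMap - rightCopy.toLinearMap

theorem doubled_apply (O : Matrix n n ℂ) : doubled O = leftCopy O + rightCopy O := rfl

theorem antidoubled_apply (O : Matrix n n ℂ) : antidoubled O = leftCopy O - rightCopy O := rfl

theorem exp_doubled (T : Matrix n n ℂ) :
    NormedSpace.exp (doubled T) = NormedSpace.exp T ⊗ₖ NormedSpace.exp T := by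
  rw [doubled_apply, exp_add_of_commute _ _ (commute_leftCopy_rightCopy T T), ← map_exp_algHom,
    ← map_exp_algHom, leftCopy_mul_rightCopy]

theorem trace_kronecker_mul_antidoubled (E O₁ O₂ : Matrix n n ℂ) :
    ((E ⊗ₖ E) * (antidoubled O₁ * antidoubled O₂)).trace =
      2 * ((E * (O₁ * O₂)).trace * E.trace - (E * O₁).trace * (E * O₂).trace) := by
  simp only [antidoubled_apply, leftCopy_apply, rightCopy_apply, sub_mul, mul_sub,
    ← mul_kronecker_mul, trace_sub, trace_kronecker, mul_one, one_mul]
  ring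

/-- The normalized functional `O ↦ Tr[e^T O] / Tr[e^T]`. For `T = -βH` it is the expectation in
the Gibbs state of `H`; for general complex `T` it is meaningful when `Tr[e^T] ≠ 0`. -/
noncomputable def gibbsFunctional (T : Matrix n n ℂ) : Matrix n n ℂ →ₗ[ℂ] ℂ :=
  (NormedSpace.exp T).trace⁻¹ • traceLinearMap n ℂ ℂ ∘ₗ LinearMap.mulLeft ℂ (NormedSpace.exp T)

theorem gibbsFunctional_apply (T O : Matrix n n ℂ) :
    gibbsFunctional T O = (NormedSpace.exp T * O).trace / (NormedSpace.exp T).trace := by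
  rw [div_eq_inv_mul]
  rfl

theorem norm_gibbsFunctional_zero_le [Nonempty n] (O : Matrix n n ℂ) :
    ‖gibbsFunctional 0 O‖ ≤ ‖O‖ := by
  rw [gibbsFunctional_apply, NormedSpace.exp_zero, one_mul, trace_one, norm_div,
    Complex.norm_natCast, div_le_iff₀' (by exact_mod_cast Fintype.card_pos)]
  exact norm_trace_le O

theorem covariance_gibbsFunctional {T : Matrix n n ℂ} (hT : (NormedSpace.exp T).trace ≠ 0)
    (O₁ O₂ : Matrix n n ℂ) :
    covariance (gibbsFunctional T) O₁ O₂ =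
      (2 * (NormedSpace.exp T).trace ^ 2)⁻¹ *
        (NormedSpace.exp (doubled T) * (antidoubled O₁ * antidoubled O₂)).trace := by
  rw [exp_doubled, trace_kronecker_mul_antidoubled, covariance, gibbsFunctional_apply,
    gibbsFunctional_apply, gibbsFunctional_apply]
  field_simp

theorem isBigO_covariance_gibbsFunctional_smul [Nonempty n] (T O₁ O₂ : Matrix n n ℂ) {k : ℕ}
    (h : ∀ j < k, (doubled T ^ j * (antidoubled O₁ * antidoubled O₂)).trace = 0) :
    (fun t : ℂ => covariance (gibbsFunctional (t • T)) O₁ O₂) =O[𝓝 0] fun t => t ^ k := by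
  have hcont : Continuous fun t : ℂ => (NormedSpace.exp (t • T)).trace := by
    simpa only [mul_one] using (differentiable_trace_exp_smul_mul T 1).continuous
  have hne : (NormedSpace.exp ((0 : ℂ) • T)).trace ≠ 0 := by simp
  have hprefactor : (fun t : ℂ => (2 * (NormedSpace.exp (t • T)).trace ^ 2)⁻¹) =O[𝓝 0]
      fun _ => (1 : ℂ) :=
    Tendsto.isBigO_one ℂ
      (((hcont.tendsto 0).pow 2).const_mul 2 |>.inv₀ (mul_ne_zero two_ne_zero (pow_ne_zero 2 hne)))
  have hproduct := hprefactor.mul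
    (isBigO_trace_exp_smul_mul (doubled T) (antidoubled O₁ * antidoubled O₂) h)
  simp only [one_mul] at hproduct
  refine hproduct.congr' ?_ EventuallyEq.rfl
  filter_upwards [hcont.continuousAt.eventually_ne hne] with t ht
  rw [covariance_gibbsFunctional ht, map_smul]

end Matrices

section Regions

variable {D R : ℕ} {Λ : Finset (Site D)} {A B A₁ A₂ : Finset Λ}

theorem siteDist_self (x : Site D) : siteDist x x = 0 := by simp [siteDist]

theorem siteDist_triangle (x y z : Site D) : siteDist x z ≤ siteDist x y + siteDist y z := by
  rw [siteDist, siteDist, siteDist, ← Finset.sum_add_distrib]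
  exact Finset.sum_le_sum fun i _ => by lia

theorem siteDist_le_regionDiam {X : Finset Λ} {x y : Λ} (hx : x ∈ X) (hy : y ∈ X) :
    siteDist (x : Site D) y ≤ regionDiam X :=
  Finset.le_sup (f := fun p : Λ × Λ => siteDist (p.1 : Site D) (p.2 : Site D))
    (Finset.mk_mem_product hx hy)

theorem regionDist_le {x y : Λ} (hx : x ∈ A) (hy : y ∈ B) :
    regionDist A B ≤ siteDist (x : Site D) y :=
  Nat.sInf_le ⟨x, hx, y, hy, rfl⟩

/- Absorbing into `A₁` the regions that meet it, one at a time, moves it by at most `R` each. -/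
theorem exists_separating_region (S : Finset (Finset Λ)) (hS : ∀ X ∈ S, regionDiam X ≤ R)
    (hdist : ∀ x ∈ A₁, ∀ y ∈ A₂, S.card * R < siteDist (x : Site D) y) :
    ∃ B, A₁ ⊆ B ∧ Disjoint A₂ B ∧ ∀ X ∈ S, X ⊆ B ∨ Disjoint X B := by
  induction S using Finset.strongInduction generalizing A₁ with
  | H S ih =>
    by_cases hmeet : ∃ X ∈ S, ¬ Disjoint X A₁
    · obtain ⟨X, hXS, hXA⟩ := hmeet
      obtain ⟨x₀, hx₀X, hx₀A⟩ := Finset.not_disjoint_iff.1 hXA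
      have hcard : S.card * R = (S.erase X).card * R + R := by
        rw [← Finset.card_erase_add_one hXS, add_mul, one_mul]
      have hdist' : ∀ x ∈ A₁ ∪ X, ∀ y ∈ A₂, (S.erase X).card * R < siteDist (x : Site D) y := by
        intro x hx y hy
        rcases Finset.mem_union.1 hx with hxA | hxX
        · have := hdist x hxA y hy
          lia
        · have := hdist x₀ hx₀A y hy
          have := siteDist_triangle (x₀ : Site D) x y
          have := (siteDist_le_regionDiam hx₀X hxX).trans (hS X hXS)
          lia
      obtain ⟨B, hA₁B, hA₂B, hB⟩ := ih (S.erase X) (Finset.erase_ssubset hXS)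
        (fun Y hY => hS Y (Finset.mem_of_mem_erase hY)) hdist'
      refine ⟨B, Finset.subset_union_left.trans hA₁B, hA₂B, fun Y hY => ?_⟩
      rcases eq_or_ne Y X with rfl | hYX
      · exact Or.inl (Finset.subset_union_right.trans hA₁B)
      · exact hB Y (Finset.mem_erase.2 ⟨hYX, hY⟩)
    · push Not at hmeet
      refine ⟨A₁, subset_rfl, Finset.disjoint_left.2 fun y hy₂ hy₁ => ?_,
        fun X hX => Or.inr (hmeet X hX)⟩
      have := hdist y hy₁ y hy₂
      rw [siteDist_self] at this
      lia

end Regions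

section LocalOperators

open Matrix

variable {D d : ℕ} {Λ : Finset (Site D)} {A B : Finset Λ} {O : Operator Λ d}

/-- The algebra embedding `M ↦ M ⊗ 1` of the operators on the sites of `A` into those on `Λ`. -/
noncomputable def regionEmbedding (A : Finset Λ) :
    Matrix (A → Fin d) (A → Fin d) ℂ →ₐ[ℂ] Operator Λ d :=
  (reindexAlgEquiv ℂ ℂ (Equiv.piEquivPiSubtypeProd (· ∈ A) fun _ => Fin d).symm).toAlgHom.comp
    leftCopy

theorem regionEmbedding_apply (M : Matrix (A → Fin d) (A → Fin d) ℂ) (σ τ : Λ → Fin d) :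
    regionEmbedding A M σ τ =
      if ∀ x, x ∉ A → σ x = τ x then M (fun x => σ x) (fun x => τ x) else 0 := by
  have hagree : (fun x : {x // x ∉ A} => σ x) = (fun x : {x // x ∉ A} => τ x) ↔
      ∀ x, x ∉ A → σ x = τ x := by
    rw [funext_iff, Subtype.forall]
  simp [regionEmbedding, leftCopy_apply, one_apply, hagree]

theorem star_regionEmbedding (M : Matrix (A → Fin d) (A → Fin d) ℂ) :
    star (regionEmbedding A M) = regionEmbedding A (star M) := by
  ext σ τ
  simp only [star_apply, regionEmbedding_apply, apply_ite star, star_zero, eq_comm]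

/-- The C⋆-algebra of the operators supported on `A`. -/
noncomputable def localAlgebra (A : Finset Λ) : StarSubalgebra ℂ (Operator Λ d) where
  toSubalgebra := (regionEmbedding A).range
  star_mem' := by
    rintro _ ⟨M, rfl⟩
    exact ⟨star M, (star_regionEmbedding M).symm⟩

theorem mem_localAlgebra : O ∈ localAlgebra A ↔ SupportedOn A O := by
  refine exists_congr fun M => ?_
  rw [eq_comm, ← Matrix.ext_iff]
  exact forall₂_congr fun σ τ => by rw [← regionEmbedding_apply]; rfl

theorem SupportedOn.mono (hO : SupportedOn A O) (hAB : A ⊆ B) : SupportedOn B O := by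
  obtain ⟨M, hM⟩ := hO
  refine ⟨of fun s t => if ∀ x : B, (x : Λ) ∉ A → s x = t x then
    M (fun x => s ⟨x, hAB x.2⟩) (fun x => t ⟨x, hAB x.2⟩) else 0, fun σ τ => ?_⟩
  have hagree : (∀ x, x ∉ A → σ x = τ x) ↔
      (∀ x, x ∉ B → σ x = τ x) ∧ ∀ x : B, (x : Λ) ∉ A → σ x = τ x :=
    ⟨fun h => ⟨fun x hx => h x fun hxA => hx (hAB hxA), fun x => h x⟩,
      fun h x hx => if hxB : x ∈ B then h.2 ⟨x, hxB⟩ hx else h.1 x hxB⟩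
  simp only [hM, of_apply, ← ite_and, hagree]

/-- The exchange of the two copies of the configuration space on the sites of `B`. -/
def exchange (B : Finset Λ) : Equiv.Perm ((Λ → Fin d) × (Λ → Fin d)) :=
  Function.Involutive.toPerm (fun p => (B.piecewise p.2 p.1, B.piecewise p.1 p.2))
    fun p => by ext x <;> by_cases hx : x ∈ B <;> simp [hx]

theorem exchange_apply (p : (Λ → Fin d) × (Λ → Fin d)) :
    exchange B p = (B.piecewise p.2 p.1, B.piecewise p.1 p.2) := rfl

/-- Conjugation by the exchange of two copies of the lattice system on the sites of `B`. -/
noncomputable def exchangeConj (B : Finset Λ) :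
    Matrix ((Λ → Fin d) × (Λ → Fin d)) ((Λ → Fin d) × (Λ → Fin d)) ℂ ≃ₐ[ℂ]
      Matrix ((Λ → Fin d) × (Λ → Fin d)) ((Λ → Fin d) × (Λ → Fin d)) ℂ :=
  reindexAlgEquiv ℂ ℂ (exchange B)

theorem exchangeConj_apply
    (M : Matrix ((Λ → Fin d) × (Λ → Fin d)) ((Λ → Fin d) × (Λ → Fin d)) ℂ) :
    exchangeConj B M = M.submatrix (exchange B) (exchange B) := rfl

theorem exchangeConj_exchangeConj
    (M : Matrix ((Λ → Fin d) × (Λ → Fin d)) ((Λ → Fin d) × (Λ → Fin d)) ℂ) :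
    exchangeConj B (exchangeConj B M) = M :=
  (exchangeConj B).symm_apply_apply M

theorem exchangeConj_univ_exchangeConj_compl
    (M : Matrix ((Λ → Fin d) × (Λ → Fin d)) ((Λ → Fin d) × (Λ → Fin d)) ℂ) :
    exchangeConj Finset.univ (exchangeConj Bᶜ M) = exchangeConj B M := by
  have hcomp (p : (Λ → Fin d) × (Λ → Fin d)) :
      exchange Bᶜ (exchange Finset.univ p) = exchange B p := by
    simp only [exchange_apply, Finset.piecewise_univ, Finset.piecewise_compl]
  ext p q
  simp only [exchangeConj_apply, submatrix_apply, hcomp]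

theorem SupportedOn.exchangeConj_leftCopy_of_subset (hO : SupportedOn A O) (hAB : A ⊆ B) :
    exchangeConj B (leftCopy O) = rightCopy O := by
  obtain ⟨M, hM⟩ := hO
  have hrestrict (σ τ : Λ → Fin d) :
      (fun x : A => B.piecewise τ σ x) = fun x : A => τ x :=
    funext fun x => Finset.piecewise_eq_of_mem _ _ _ (hAB x.2)
  ext ⟨σ, τ⟩ ⟨σ', τ'⟩
  have hagree : ((B.piecewise σ τ = B.piecewise σ' τ') ∧
      ∀ x, x ∉ A → B.piecewise τ σ x = B.piecewise τ' σ' x) ↔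
      (∀ x, x ∉ A → τ x = τ' x) ∧ σ = σ' := by
    simp only [funext_iff, Finset.piecewise]
    grind
  simp only [exchangeConj_apply, leftCopy_apply, rightCopy_apply, submatrix_apply,
    exchange_apply, kroneckerMap_apply, one_apply, hM, hrestrict, mul_ite, ite_mul, mul_one,
    one_mul, mul_zero, zero_mul, ← ite_and, hagree]

theorem SupportedOn.exchangeConj_rightCopy_of_subset (hO : SupportedOn A O) (hAB : A ⊆ B) :
    exchangeConj B (rightCopy O) = leftCopy O := by
  rw [← hO.exchangeConj_leftCopy_of_subset hAB, exchangeConj_exchangeConj]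

theorem SupportedOn.exchangeConj_leftCopy_of_disjoint (hO : SupportedOn A O)
    (hAB : Disjoint A B) : exchangeConj B (leftCopy O) = leftCopy O := by
  rw [← exchangeConj_univ_exchangeConj_compl,
    hO.exchangeConj_leftCopy_of_subset (Finset.subset_compl_iff_disjoint_right.2 hAB),
    hO.exchangeConj_rightCopy_of_subset (Finset.subset_univ A)]

theorem SupportedOn.exchangeConj_rightCopy_of_disjoint (hO : SupportedOn A O)
    (hAB : Disjoint A B) : exchangeConj B (rightCopy O) = rightCopy O := by
  rw [← exchangeConj_univ_exchangeConj_compl,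
    hO.exchangeConj_rightCopy_of_subset (Finset.subset_compl_iff_disjoint_right.2 hAB),
    hO.exchangeConj_leftCopy_of_subset (Finset.subset_univ A)]

theorem SupportedOn.exchangeConj_doubled (hO : SupportedOn A O) (hAB : A ⊆ B ∨ Disjoint A B) :
    exchangeConj B (doubled O) = doubled O := by
  rw [doubled_apply, map_add]
  rcases hAB with hAB | hAB
  · rw [hO.exchangeConj_leftCopy_of_subset hAB, hO.exchangeConj_rightCopy_of_subset hAB, add_comm]
  · rw [hO.exchangeConj_leftCopy_of_disjoint hAB, hO.exchangeConj_rightCopy_of_disjoint hAB]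

theorem SupportedOn.exchangeConj_antidoubled_of_subset (hO : SupportedOn A O) (hAB : A ⊆ B) :
    exchangeConj B (antidoubled O) = -antidoubled O := by
  rw [antidoubled_apply, map_sub, hO.exchangeConj_leftCopy_of_subset hAB,
    hO.exchangeConj_rightCopy_of_subset hAB, neg_sub]

theorem SupportedOn.exchangeConj_antidoubled_of_disjoint (hO : SupportedOn A O)
    (hAB : Disjoint A B) : exchangeConj B (antidoubled O) = antidoubled O := by
  rw [antidoubled_apply, map_sub, hO.exchangeConj_leftCopy_of_disjoint hAB,
    hO.exchangeConj_rightCopy_of_disjoint hAB]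

end LocalOperators

section FiniteRange

variable {D d R k : ℕ} {Λ : Finset (Site D)} {A₁ A₂ : Finset Λ} {O₁ O₂ : Operator Λ d}
  {Φ : Finset Λ → Operator Λ d}

theorem trace_prod_doubled_mul_antidoubled_eq_zero (hΦ : ∀ X, SupportedOn X (Φ X))
    (hO₁ : SupportedOn A₁ O₁) (hO₂ : SupportedOn A₂ O₂) (X : Fin k → Finset Λ)
    (hX : ∀ i, regionDiam (X i) ≤ R)
    (hdist : ∀ x ∈ A₁, ∀ y ∈ A₂, k * R < siteDist (x : Site D) y) :
    ((List.ofFn fun i => doubled (Φ (X i))).prod *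
      (antidoubled O₁ * antidoubled O₂)).trace = 0 := by
  have hcard : (Finset.univ.image X).card ≤ k :=
    Finset.card_image_le.trans_eq (Finset.card_fin k)
  obtain ⟨B, hA₁B, hA₂B, hXB⟩ := exists_separating_region (Finset.univ.image X)
    (by simpa using hX)
    fun x hx y hy => (Nat.mul_le_mul_right R hcard).trans_lt (hdist x hx y hy)
  have hfixed (i : Fin k) : exchangeConj B (doubled (Φ (X i))) = doubled (Φ (X i)) :=
    (hΦ (X i)).exchangeConj_doubled (hXB _ (Finset.mem_image_of_mem X (Finset.mem_univ i)))
  refine trace_eq_zero_of_submatrix_eq_neg (exchange B) ?_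
  rw [← exchangeConj_apply, map_mul, map_mul, map_list_prod, List.map_ofFn,
    hO₁.exchangeConj_antidoubled_of_subset hA₁B, hO₂.exchangeConj_antidoubled_of_disjoint hA₂B,
    neg_mul, mul_neg]
  simp only [Function.comp_def, hfixed]

theorem trace_doubled_sum_pow_mul_antidoubled_eq_zero (hΦ : ∀ X, SupportedOn X (Φ X))
    (hrange : ∀ X, R < regionDiam X → Φ X = 0)
    (hO₁ : SupportedOn A₁ O₁) (hO₂ : SupportedOn A₂ O₂)
    (hdist : ∀ x ∈ A₁, ∀ y ∈ A₂, k * R < siteDist (x : Site D) y) :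
    (doubled (∑ X, Φ X) ^ k * (antidoubled O₁ * antidoubled O₂)).trace = 0 := by
  rw [map_sum, sum_pow_eq_sum_prod_ofFn, Finset.sum_mul, Matrix.trace_sum]
  refine Finset.sum_eq_zero fun X _ => ?_
  by_cases hX : ∀ i, regionDiam (X i) ≤ R
  · exact trace_prod_doubled_mul_antidoubled_eq_zero hΦ hO₁ hO₂ X hX hdist
  · push Not at hX
    obtain ⟨i, hi⟩ := hX
    have hzero : (0 : Matrix _ _ ℂ) ∈ List.ofFn fun i => doubled (Φ (X i)) :=
      List.mem_ofFn.2 ⟨i, by rw [hrange _ hi, map_zero]⟩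
    rw [List.prod_eq_zero hzero, zero_mul, Matrix.trace_zero]

theorem isBigO_covariance_gibbsFunctional_sum [Nonempty (Λ → Fin d)]
    (hΦ : ∀ X, SupportedOn X (Φ X)) (hrange : ∀ X, R < regionDiam X → Φ X = 0)
    (hO₁ : SupportedOn A₁ O₁) (hO₂ : SupportedOn A₂ O₂)
    (hk : ∀ j < k, ∀ x ∈ A₁, ∀ y ∈ A₂, j * R < siteDist (x : Site D) y) :
    (fun t : ℂ => covariance (gibbsFunctional (t • ∑ X, Φ X)) O₁ O₂) =O[𝓝 0]
      fun t => t ^ k :=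
  isBigO_covariance_gibbsFunctional_smul _ O₁ O₂ fun j hj =>
    trace_doubled_sum_pow_mul_antidoubled_eq_zero hΦ hrange hO₁ hO₂ (hk j hj)

end FiniteRange

section ZeroFreeInteractions

variable {D d K κ R : ℕ} {c h δ β : ℝ} {Λ : Finset (Site D)} {A : Finset Λ}

/-- `Tr[e^T N] ≠ 0` for every nonzero positive operator `N` supported on `A`: the condition on
`T = -zH` that analyticity after measurement provides, without the normalization of `N`. -/
def IsZeroFreeOn (A : Finset Λ) (T : Operator Λ d) : Prop :=
  ∀ N : Operator Λ d, SupportedOn A N → N.PosSemidef → N ≠ 0 → (NormedSpace.exp T * N).trace ≠ 0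

theorem IsZeroFreeOn.trace_exp_ne_zero [Nonempty (Λ → Fin d)] {T : Operator Λ d}
    (hT : IsZeroFreeOn A T) : (NormedSpace.exp T).trace ≠ 0 := by
  simpa only [mul_one] using
    hT 1 (mem_localAlgebra.1 (one_mem _)) Matrix.PosSemidef.one one_ne_zero

theorem zeroFreeFamily_gibbsFunctional [Nonempty (Λ → Fin d)] {T : Operator Λ d} {r : ℝ}
    {ψ : ℂ → ℂ} (hψ : DifferentiableOn ℂ ψ (ball 0 r)) (hψ0 : ψ 0 = 0)
    (hT : ∀ w ∈ ball (0 : ℂ) r, IsZeroFreeOn A (ψ w • T)) :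
    ZeroFreeFamily (localAlgebra A) r fun w => gibbsFunctional (ψ w • T) where
  differentiableOn O _ := by
    have hdiff (O : Operator Λ d) :
        DifferentiableOn ℂ (fun w => (NormedSpace.exp (ψ w • T) * O).trace) (ball 0 r) :=
      (differentiable_trace_exp_smul_mul T O).comp_differentiableOn hψ
    simp only [gibbsFunctional_apply]
    exact (hdiff O).div (by simpa only [mul_one] using hdiff 1)
      fun w hw => (hT w hw).trace_exp_ne_zero
  map_one w hw := by
    rw [gibbsFunctional_apply, mul_one, div_self (hT w hw).trace_exp_ne_zero]
  norm_zero_le O _ := by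
    rw [hψ0, zero_smul]
    exact norm_gibbsFunctional_zero_le O
  ne_zero w hw O hO hO0 hne := by
    rw [gibbsFunctional_apply]
    exact div_ne_zero (hT w hw O (mem_localAlgebra.1 hO) (Matrix.nonneg_iff_posSemidef.1 hO0) hne)
      (hT w hw).trace_exp_ne_zero

theorem norm_covariance_gibbsFunctional_sum_le [Nonempty (Λ → Fin d)]
    {Φ : Finset Λ → Operator Λ d} (hΦ : ∀ X, SupportedOn X (Φ X))
    (hrange : ∀ X, R < regionDiam X → Φ X = 0) {A₁ A₂ : Finset Λ} {O₁ O₂ : Operator Λ d}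
    (hO₁ : SupportedOn A₁ O₁) (hO₂ : SupportedOn A₂ O₂) {ψ : ℂ → ℂ} {r ρ : ℝ}
    (hψ : DifferentiableOn ℂ ψ (ball 0 r)) (hψ0 : ψ 0 = 0)
    (hzero : ∀ w ∈ ball (0 : ℂ) r, IsZeroFreeOn (A₁ ∪ A₂) (ψ w • ∑ X, Φ X))
    (hρ : ρ < r) {w : ℂ} (hw : w ∈ ball 0 ρ) :
    ‖covariance (gibbsFunctional (ψ w • ∑ X, Φ X)) O₁ O₂‖ ≤
      (10 * (4 * r / (r - ρ)) ^ 2 + (10 * (4 * r / (r - ρ)) ^ 2) ^ 2) * ‖O₁‖ * ‖O₂‖ *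
        (‖w‖ / ρ) ^ ((regionDist A₁ A₂ + R) / (R + 1)) := by
  have hdist : ∀ j < (regionDist A₁ A₂ + R) / (R + 1), ∀ x ∈ A₁, ∀ y ∈ A₂,
      j * R < siteDist (x : Site D) y := by
    intro j hj x hx y hy
    have := (Nat.le_div_iff_mul_le R.succ_pos).1 hj
    have := regionDist_le hx hy
    lia
  have hr : 0 < r := (norm_nonneg w).trans_lt ((mem_ball_zero_iff.1 hw).trans hρ)
  have hvanish := isBigO_pow_comp
    (isBigO_covariance_gibbsFunctional_sum hΦ hrange hO₁ hO₂ hdist)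
    (hψ.differentiableAt (ball_mem_nhds 0 hr)) hψ0
  exact (zeroFreeFamily_gibbsFunctional hψ hψ0 hzero).norm_covariance_le_mul_pow
    (mem_localAlgebra.2 (hO₁.mono Finset.subset_union_left))
    (mem_localAlgebra.2 (hO₂.mono Finset.subset_union_right)) hvanish hρ hw

theorem inv_pow_div_le_exp {ρ : ℝ} (hρ : 1 < ρ) (n R : ℕ) :
    ρ⁻¹ ^ ((n + R) / (R + 1)) ≤ Real.exp (-n / ((R + 1) / Real.log ρ)) := by
  have hlog : 0 < Real.log ρ := Real.log_pos hρ
  have hn : (n : ℝ) ≤ ((n + R) / (R + 1) : ℕ) * (R + 1) := by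
    have := (Nat.div_lt_iff_lt_mul R.succ_pos).1 (Nat.lt_succ_self ((n + R) / (R + 1)))
    rw [Nat.succ_mul] at this
    exact_mod_cast (by lia : n ≤ (n + R) / (R + 1) * (R + 1))
  rw [← Real.exp_log (inv_pos.2 (one_pos.trans hρ)), Real.log_inv, ← Real.exp_nat_mul,
    Real.exp_le_exp, div_div_eq_mul_div, le_div_iff₀ (by positivity)]
  nlinarith

theorem LocalHamiltonian.weighted_const (H : LocalHamiltonian Λ d κ R h) (z : ℂ) :
    H.weighted (fun _ => z) = z • ∑ X, H.term X := by
  rw [weighted, Finset.smul_sum]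

theorem LocalHamiltonian.trace_gibbs_mul (H : LocalHamiltonian Λ d κ R h) (O : Operator Λ d) :
    (H.gibbs β * O).trace = gibbsFunctional (-(β : ℂ) • ∑ X, H.term X) O := by
  rw [gibbs, weighted_const, ← neg_smul, smul_mul_assoc, Matrix.trace_smul, smul_eq_mul,
    gibbsFunctional_apply, div_eq_inv_mul]

theorem LocalHamiltonian.AnalyticAfterMeasurement.isZeroFreeOn
    {H : LocalHamiltonian Λ d κ R h} (hH : H.AnalyticAfterMeasurement K δ c β) (hA : A.card ≤ K)
    {z : ℂ} (hz : ‖z - β‖ ≤ δ) : IsZeroFreeOn A (-z • ∑ X, H.term X) := by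
  intro N hN hpos hN0 htrace
  have hnorm : 0 < ‖N‖ := norm_pos_iff.2 hN0
  have hunit : ‖((‖N‖⁻¹ : ℝ) : ℂ) • N‖ = 1 := by
    rw [norm_smul, Complex.norm_real, norm_inv, norm_norm, inv_mul_cancel₀ hnorm.ne']
  refine (hH A (((‖N‖⁻¹ : ℝ) : ℂ) • N) hA
    (mem_localAlgebra.1 (SMulMemClass.smul_mem _ (mem_localAlgebra.2 hN)))
    (hpos.smul (by exact_mod_cast (inv_pos.2 hnorm).le)) hunit (fun _ => z) fun _ => hz).1 ?_
  rw [H.weighted_const, ← neg_smul, mul_smul_comm, Matrix.trace_smul, htrace, smul_zero]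

end ZeroFreeInteractions

end QuantumLattice

open QuantumLattice in
theorem mainTheorem5_general (R : ℕ) {δ β : ℝ} (hδ : 0 < δ) (hβ : 0 ≤ β) :
    ∃ C ξ : ℝ, 0 < C ∧ 0 < ξ ∧ ∀ {D d : ℕ} {Λ : Finset (Site D)} (Φ : Finset Λ → Operator Λ d),
      (∀ X, SupportedOn X (Φ X)) → (∀ X, R < regionDiam X → Φ X = 0) →
      ∀ (A₁ A₂ : Finset Λ) (O₁ O₂ : Operator Λ d), SupportedOn A₁ O₁ → SupportedOn A₂ O₂ →
        (∀ β' ∈ Set.Icc 0 β, ∀ z : ℂ, ‖z - β'‖ ≤ δ →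
          IsZeroFreeOn (A₁ ∪ A₂) (-z • ∑ X, Φ X)) →
        ‖covariance (gibbsFunctional (-(β : ℂ) • ∑ X, Φ X)) O₁ O₂‖ ≤
          C * ‖O₁‖ * ‖O₂‖ * Real.exp (-(regionDist A₁ A₂ : ℝ) / ξ) := by
  obtain ⟨r, hr, ψ, hψ, hψ0, hψ1, hψδ⟩ := exists_disc_map_near_segment hβ hδ
  obtain ⟨ρ, hρ, hρr⟩ := exists_between hr
  have : 0 < r := one_pos.trans hr
  have : 0 < r - ρ := sub_pos.2 hρr
  refine ⟨10 * (4 * r / (r - ρ)) ^ 2 + (10 * (4 * r / (r - ρ)) ^ 2) ^ 2,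
    (R + 1) / Real.log ρ, by positivity, div_pos (by positivity) (Real.log_pos hρ), ?_⟩
  intro D d Λ Φ hΦ hrange A₁ A₂ O₁ O₂ hO₁ hO₂ hzero
  rcases isEmpty_or_nonempty (Λ → Fin d) with _ | _
  · simp [covariance, Subsingleton.elim O₁ 0]
  have hzero' : ∀ w ∈ ball (0 : ℂ) r, IsZeroFreeOn (A₁ ∪ A₂) (-ψ w • ∑ X, Φ X) := fun w hw =>
    let ⟨β', hβ', hdist⟩ := hψδ w hw
    hzero β' hβ' (ψ w) hdist
  have hone : (1 : ℂ) ∈ ball 0 ρ := by simpa using hρ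
  have hbound := norm_covariance_gibbsFunctional_sum_le hΦ hrange hO₁ hO₂ hψ.fun_neg
    (by rw [hψ0, neg_zero]) hzero' hρr hone
  rw [hψ1, norm_one, one_div] at hbound
  grw [hbound, inv_pow_div_le_exp hρ]

theorem mainTheorem5 (D d κ R K : ℕ) (h δ βc : ℝ) (c : ℝ → ℝ) (hδ : 0 < δ)
    (β : ℝ) (hβ : β ∈ Set.Ico 0 βc) :
    ∃ C ξ : ℝ, 0 < C ∧ 0 < ξ ∧
      ∀ (Λ : Finset (QuantumLattice.Site D))
        (H : QuantumLattice.LocalHamiltonian Λ d κ R h),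
        H.MutuallyCommuting →
        (∀ β' ∈ Set.Ico 0 βc, H.AnalyticAfterMeasurement K δ (c β') β') →
        H.ExponentialDecay K C ξ β := by
  obtain ⟨C, ξ, hC, hξ, hdecay⟩ := mainTheorem5_general R hδ hβ.1
  refine ⟨C, ξ, hC, hξ, fun Λ H _ hH A₁ A₂ O₁ O₂ hK hO₁ hO₂ _ _ => ?_⟩
  rw [mul_assoc, H.trace_gibbs_mul, H.trace_gibbs_mul, H.trace_gibbs_mul]
  exact hdecay H.term H.supportedOn (fun X hX => H.eq_zero X (Or.inl hX)) A₁ A₂ O₁ O₂ hO₁ hO₂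
    fun β' hβ' z hz => (hH β' ⟨hβ'.1, hβ'.2.trans_lt hβ.2⟩).isZeroFreeOn
      ((Finset.card_union_le A₁ A₂).trans hK) hz
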